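/- Let $m,n\in\mathbb N$, $d=m+n$, and let $T\subseteq\mathbb R_-^m\times\mathbb R^n$ be a production set (inputs are counted negatively) such that: (T1) $0\in T$, and $(0,y)\notin T$ whenever $y\ge 0$, $y\neq 0$; (T2) for every $z\in T$ the set $T_z=\{u\in T: u\ge z\}$ is bounded; (T3) $T$ is closed; (T4) if $z\in T$ and $z'\le z$, then $z'\in T$. Let $z\in T$ and $g\in\mathbb R_+^d\setminus\{0\}$, and put $K_g=\{k: g_k\neq 0\}$, $d_g=|K_g|$. For real $r\neq0$ and nonnegative $(\delta_k)_{k\in K_g}$ let $S_r(\delta)=\big(\sum_{k\in K_g}\delta_k^{\,r}\big)^{1/r}$, with $S_r(\delta)=0$ if $r<0$ and $\min_{k\in K_g}\delta_k=0$. With $\odot$ the componentwise product, define $$D_{(p)}(z;g)=\sup\big\{d_g^{-1/p}S_p(\delta):\delta\in\mathbb R_+^d,\ z+\delta\odot g\in T\big\}\quad(p\in\mathbb R\setminus\{0\}),$$ $$D_{(0)}(z;g)=\sup\Big\{\prod_{k\in K_g}\delta_k^{1/d_g}:\delta\in\mathbb R_+^d,\ z+\delta\odot g\in T\Big\},\qquad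 D_{FL}(z;g)=\sup\Big\{\tfrac1{d_g}\sum_{k\in K_g}\delta_k:\delta\in\mathbb R_+^d,\ z+\delta\odot g\in T\Big\},$$ $$D(z;g)=\sup\{\delta\in\mathbb R: z+\delta g\in T\}\ (\text{the case }p=-\infty),\qquad AD(z;g)=\max_{k\in K_g}D(z;g_ke_k)\ (\text{the case }p=\infty),$$ where $e_k$ is the $k$-th canonical basis vector, and, for $w\in\mathbb R_+^d$, the profit functions $$\Pi_z(w)=\sup\{w\cdot u:u\in T_z\},\qquad \Pi_{z,g}(w)=\sup\{w\cdot u:u\in T_z,\ u_k=z_k\text{ for all }k\notin K_g\}.$$ Then, with $w$ ranging over $\mathbb R_+^d$: (a) for all real $p>1$, with $\frac1p+\frac1q=1$, $$D_{(p)}(z;g)=\sup_{w\ge0}\Big\{\Pi_{z,g}(w)-w\cdot z:\ d_g^{\frac{q-1}{q}}\Big(\sum_{k\in K_g}(g_kw_k)^q\Big)^{1/q}=1\Big\};$$ (b) for $p=1$, $$D_{(1)}(z;g)=D_{FL}(z;g)=\sup_{w\ge0}\Big\{\Pi_{z,g}(w)-w\cdot z:\ d_g\max_{k\in K_g}w_kg_k=1\Big\};$$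 (c) for $p=\infty$, $$AD(z;g)=\sup_{w\ge0}\{\Pi_{z,g}(w)-w\cdot z:\ w\cdot g=1\}.$$ If moreover (T5) $T$ is convex, then: (d) for $p=0$, $$D_{(0)}(z;g)=\inf_{w\ge0}\Big\{\Pi_z(w)-w\cdot z:\ d_g\prod_{k\in K_g}(g_kw_k)^{1/d_g}=1\Big\};$$ (e) for all real $p<1$, $p\ne0$, with $\frac1p+\frac1q=1$, $$D_{(p)}(z;g)=\inf_{w\ge0}\Big\{\Pi_z(w)-w\cdot z:\ d_g^{\frac{q-1}{q}}\,S_q\big((g_kw_k)_{k\in K_g}\big)=1\Big\};$$ (f) for $p=-\infty$, $$D(z;g)=\inf_{w\ge0}\{\Pi_z(w)-w\cdot z:\ w\cdot g=1\}.$$ -/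

import Mathlib

namespace NetputDuality

/-- Netput vectors with `m` inputs (left summand) and `n` outputs (right summand). -/
abbrev Netput (m n : ℕ) : Type := Fin m ⊕ Fin n → ℝ

/-- The netputs of `T` that dominate `z`. -/
def dominating {m n : ℕ} (T : Set (Netput m n)) (z : Netput m n) : Set (Netput m n) :=
  {u | u ∈ T ∧ z ≤ u}

/-- The standing assumptions on a production set `T ⊆ ℝ₋^m × ℝ^n`: inaction is possible and there
is no free lunch (T1), the dominating sets are bounded (T2), `T` is closed (T3), and netputs are
freely disposable (T4). -/
structure IsTechnology {m n : ℕ} (T : Set (Netput m n)) : Prop where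
  input_nonpos : ∀ z ∈ T, ∀ i : Fin m, z (Sum.inl i) ≤ 0
  zero_mem : (0 : Netput m n) ∈ T
  no_free_lunch : ∀ y : Fin n → ℝ, 0 ≤ y → y ≠ 0 → (Sum.elim 0 y : Netput m n) ∉ T
  bounded : ∀ z ∈ T, Bornology.IsBounded (dominating T z)
  closed : IsClosed T
  free_disposal : ∀ z ∈ T, ∀ z' : Netput m n, z' ≤ z → z' ∈ T

/-- The support `K_g` of a direction `g`. -/
noncomputable def supp {m n : ℕ} (g : Netput m n) : Finset (Fin m ⊕ Fin n) :=
  Finset.univ.filter fun k => g k ≠ 0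

theorem supp_nonempty {m n : ℕ} {g : Netput m n} (hg : g ≠ 0) : (supp g).Nonempty := by
  obtain ⟨k, hk⟩ := Function.ne_iff.mp hg
  exact ⟨k, by simpa [supp] using hk⟩

/-- The number `d_g` of elements of the support of `g`. -/
noncomputable def suppCard {m n : ℕ} (g : Netput m n) : ℝ := ((supp g).card : ℝ)

open Classical in
/-- The `φ_p`-generalized sum over `K` of the nonnegative family `δ`, for `p ≠ 0`: it is
`(∑ δ_k ^ p) ^ (1 / p)`, where for `p < 0` the value is `0` as soon as some `δ_k` vanishes. -/
noncomputable def phiSum {ι : Type*} (p : ℝ) (K : Finset ι) (δ : ι → ℝ) : ℝ :=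
  if p < 0 ∧ ∃ k ∈ K, δ k = 0 then 0 else (∑ k ∈ K, δ k ^ p) ^ (1 / p)

/-- The directional distance function `D(z; g)`. -/
noncomputable def directionalDist {m n : ℕ} (T : Set (Netput m n)) (z g : Netput m n) : EReal :=
  ⨆ (δ : ℝ) (_ : z + δ • g ∈ T), (δ : EReal)

/-- The asymmetric directional distance function `AD(z; g)`. -/
noncomputable def asymmetricDist {m n : ℕ} (T : Set (Netput m n)) (z g : Netput m n) : EReal :=
  ⨆ k ∈ supp g, directionalDist T z (Pi.single k (g k))

open Classical in
/-- For an aggregator `A` of nonnegative vectors, the supremum of `A δ` over the `δ ≥ 0` such that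
`z + δ ⊙ g ∈ T`; it is `-∞` if `z ∉ T`, and `+∞` if `z ∈ T` and `g = 0`. -/
noncomputable def slackDist {m n : ℕ} (A : Netput m n → ℝ) (T : Set (Netput m n))
    (z g : Netput m n) : EReal :=
  if z ∉ T then ⊥ else if g = 0 then ⊤ else
    ⨆ (δ : Netput m n) (_ : 0 ≤ δ) (_ : z + δ * g ∈ T), (A δ : EReal)

/-- The generalized directional Färe–Lovell distance function `D_(p)(z; g)`, for `p ≠ 0`. -/
noncomputable def genDist {m n : ℕ} (p : ℝ) (T : Set (Netput m n)) (z g : Netput m n) : EReal :=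
  slackDist (fun δ => 1 / suppCard g ^ (1 / p) * phiSum p (supp g) δ) T z g

/-- The directional Färe–Lovell distance function `D_FL(z; g)`. -/
noncomputable def fareLovellDist {m n : ℕ} (T : Set (Netput m n)) (z g : Netput m n) : EReal :=
  slackDist (fun δ => 1 / suppCard g * ∑ k ∈ supp g, δ k) T z g

/-- The multiplicative directional Färe–Lovell distance function `D_(0)(z; g)`. -/
noncomputable def multDist {m n : ℕ} (T : Set (Netput m n)) (z g : Netput m n) : EReal :=
  slackDist (fun δ => ∏ k ∈ supp g, δ k ^ (1 / suppCard g)) T z g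

/-- The profit function `Π_z(w)`, restricted to the netputs that dominate `z`. -/
noncomputable def profit {m n : ℕ} (T : Set (Netput m n)) (z w : Netput m n) : EReal :=
  ⨆ u ∈ dominating T z, ((w ⬝ᵥ u : ℝ) : EReal)

/-- The profit function `Π_{z,g}(w)`: in addition, the netputs outside the support of `g` are kept
at their levels in `z`. -/
noncomputable def profitDir {m n : ℕ} (T : Set (Netput m n)) (z g w : Netput m n) : EReal :=
  ⨆ (u : Netput m n) (_ : u ∈ dominating T z) (_ : ∀ k, k ∉ supp g → u k = z k),
    ((w ⬝ᵥ u : ℝ) : EReal)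

end NetputDuality

open NetputDuality

/-!
Along the direction `g`, each distance function maximizes an aggregator `A` of the slacks `δ` over
the feasible ones, and the profit `w · (u - z)` becomes the linear form `∑ g_k w_k δ_k`. In (a)–(c)
the aggregator is a maximum of linear forms over the weights normalized by its polar gauge `N`
(Hölder's inequality with its equality case), so the duality is an exchange of two suprema.
In (d)–(f) it is a minimum of such forms, and the reverse Hölder inequality gives `≤`. For `≥`, if
`A ≤ s` on the feasible slacks, then a hyperplane separates this convex set, pushed by a small `ε`
into the interior of the orthant, from the superlevel set `{A > s}`. Its normal is nonnegative
because the superlevel set is upward closed, and polarity bounds its value on the feasible slacks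
by `N v * t` for any `t > s`.
-/

namespace NetputDuality

open Finset Filter Topology

section Separation

variable {ι : Type*} [Finite ι] {K : Finset ι}

theorem exists_shift_le_add {A : (ι → ℝ) → ℝ} (hA : ContinuousOn A {x | 0 ≤ x})
    (hAK : DependsOn A K) (b : ι → ℝ) {η : ℝ} (hη : 0 < η) :
    ∃ ε > 0, ∀ x : ι → ℝ, (∀ k ∈ K, 0 ≤ x k ∧ x k ≤ b k) →
      A (fun k => x k + ε) ≤ A x + η := by
  cases nonempty_fintype ι
  have hunif := (isCompact_Icc (a := (0 : ι → ℝ)) (b := fun k => |b k| + 1))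
    |>.uniformContinuousOn_of_continuous (hA.mono fun x hx => hx.1)
  obtain ⟨r, hr, hAr⟩ := Metric.uniformContinuousOn_iff.mp hunif η hη
  obtain ⟨ε, hε, hεr⟩ := exists_between (lt_min hr one_pos)
  refine ⟨ε, hε, fun x hx => ?_⟩
  have hε1 : ε ≤ 1 := (hεr.trans_le (min_le_right _ _)).le
  set y : ι → ℝ := (K : Set ι).indicator x
  have hyK : ∀ k ∈ K, y k = x k := fun k hk => Set.indicator_of_mem (mem_coe.2 hk) x
  have hy0 : 0 ≤ y := fun k => Set.indicator_nonneg (fun j hj => (hx j hj).1) k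
  have hyb : ∀ k, y k ≤ |b k| := fun k =>
    Set.indicator_apply_le' (fun hk => (hx k hk).2.trans (le_abs_self _)) fun _ => abs_nonneg _
  have hdist : dist (fun k => y k + ε) y < r := by
    refine lt_of_le_of_lt ((dist_pi_le_iff hε.le).2 fun k => ?_) (hεr.trans_le (min_le_left _ _))
    rw [Real.dist_eq, add_sub_cancel_left, abs_of_pos hε]
  have hA_lt := hAr (fun k => y k + ε)
    ⟨fun k => add_nonneg (hy0 k) hε.le, fun k => add_le_add (hyb k) hε1⟩ y
    ⟨hy0, fun k => (hyb k).trans (le_add_of_nonneg_right zero_le_one)⟩ hdist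
  have hAy : A y = A x := hAK hyK
  have hAyε : A (fun k => y k + ε) = A (fun k => x k + ε) :=
    hAK fun k hk => congrArg (· + ε) (hyK k hk)
  rw [hAy, hAyε, Real.dist_eq] at hA_lt
  linarith [(abs_lt.mp hA_lt).2]

theorem exists_nonneg_weight_of_disjoint {U F : Set (ι → ℝ)} (hUo : IsOpen U)
    (hUc : Convex ℝ U) (hUne : U.Nonempty)
    (hU : ∀ x ∈ U, ∀ y : ι → ℝ, (∀ k ∈ K, x k ≤ y k) → y ∈ U) (hF : Convex ℝ F)
    (hdisj : Disjoint U F) :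
    ∃ (c : ι → ℝ) (u : ℝ), 0 ≤ c ∧ (∀ x ∈ U, u < ∑ k ∈ K, c k * x k) ∧
      ∀ x ∈ F, ∑ k ∈ K, c k * x k ≤ u := by
  classical
  cases nonempty_fintype ι
  obtain ⟨f, u, hfU, hfF⟩ := geometric_hahn_banach_open hUc hUo hF hdisj
  have hf_nonpos : ∀ h : ι → ℝ, (∀ k ∈ K, 0 ≤ h k) → f h ≤ 0 := by
    intro h hh
    by_contra! hpos
    obtain ⟨x, hx⟩ := hUne
    have hr : 0 ≤ (u - f x) / f h := div_nonneg (sub_nonneg.2 (hfU x hx).le) hpos.le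
    have hlt := hfU (x + ((u - f x) / f h) • h) <|
      hU x hx _ fun k hk => le_add_of_nonneg_right (mul_nonneg hr (hh k hk))
    rw [map_add, map_smul, smul_eq_mul, div_mul_cancel₀ _ hpos.ne', add_sub_cancel] at hlt
    exact hlt.false
  have hf_off : ∀ k ∉ K, f (Pi.single k 1) = 0 := by
    intro k hk
    have hzero : ∀ j ∈ K, (Pi.single k 1 : ι → ℝ) j = 0 := fun j hj =>
      Pi.single_eq_of_ne (fun hjk : j = k => hk (hjk ▸ hj)) 1
    refine le_antisymm (hf_nonpos _ fun j hj => (hzero j hj).ge) ?_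
    have h := hf_nonpos (-Pi.single k 1) fun j hj => by rw [Pi.neg_apply, hzero j hj, neg_zero]
    rwa [map_neg, neg_nonpos] at h
  have hf_eq : ∀ x : ι → ℝ, ∑ k ∈ K, -f (Pi.single k 1) * x k = -f x := by
    intro x
    conv_rhs => rw [← univ_sum_single x, map_sum]
    rw [← sum_neg_distrib, sum_subset (subset_univ K)]
    · refine sum_congr rfl fun k _ => ?_
      have hsmul : (Pi.single k (x k) : ι → ℝ) = x k • Pi.single k (1 : ℝ) := by
        rw [← Pi.single_smul, smul_eq_mul, mul_one]
      rw [hsmul, map_smul, smul_eq_mul]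
      ring
    · intro k _ hk
      rw [hf_off k hk, neg_zero, zero_mul]
  refine ⟨fun k => -f (Pi.single k 1), -u, fun k => ?_, fun x hx => ?_, fun x hx => ?_⟩
  · exact neg_nonneg.2 (hf_nonpos _ fun j _ =>
      (Pi.single_nonneg.2 zero_le_one : (0 : ι → ℝ) ≤ Pi.single k 1) j)
  · rw [hf_eq]
    exact neg_lt_neg (hfU x hx)
  · rw [hf_eq]
    exact neg_le_neg (hfF x hx)

end Separation

section PolarPairs

variable {ι : Type*} {K : Finset ι} {A N : (ι → ℝ) → ℝ}

/-- A normalization of the weights on `K`: a function of the coordinates in `K` that is positively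
homogeneous of degree one on nonnegative vectors. -/
structure IsNormalization (K : Finset ι) (N : (ι → ℝ) → ℝ) : Prop where
  dependsOn : DependsOn N K
  map_smul : ∀ {r : ℝ} {v : ι → ℝ}, 0 < r → (∀ k ∈ K, 0 ≤ v k) → N (r • v) = r * N v

/-- `A` is the convex gauge polar to the normalization `N`: on nonnegative vectors, `A x` is the
largest value of `∑ v_k x_k` over the weights `v` with `N v = 1`. -/
structure IsConvexPolarPair (K : Finset ι) (A N : (ι → ℝ) → ℝ) : Prop
    extends IsNormalization K N where
  sum_le_mul : ∀ {v x : ι → ℝ}, (∀ k ∈ K, 0 ≤ v k) → (∀ k ∈ K, 0 ≤ x k) →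
    ∑ k ∈ K, v k * x k ≤ N v * A x
  exists_weight : ∀ {x : ι → ℝ}, (∀ k ∈ K, 0 ≤ x k) →
    ∃ v : ι → ℝ, (∀ k ∈ K, 0 ≤ v k) ∧ 0 < N v ∧ N v * A x ≤ ∑ k ∈ K, v k * x k

/-- `A` and `N` are concave gauges polar to each other: on positive vectors, `A x` is the least
value of `∑ v_k x_k` over the weights `v` with `N v = 1`, and `N v` is the infimum of `∑ v_k x_k`
over the positive `x` with `A x = 1`. The latter need not be attained at the boundary of the
orthant, whence the slack `ε`. -/
structure IsConcavePolarPair (K : Finset ι) (A N : (ι → ℝ) → ℝ) : Prop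
    extends IsNormalization K N where
  mul_le_sum : ∀ {v x : ι → ℝ}, (∀ k ∈ K, 0 ≤ v k) → (∀ k ∈ K, 0 ≤ x k) →
    N v * A x ≤ ∑ k ∈ K, v k * x k
  exists_weight : ∀ {x : ι → ℝ}, (∀ k ∈ K, 0 < x k) →
    ∃ v : ι → ℝ, (∀ k ∈ K, 0 ≤ v k) ∧ 0 < N v ∧ ∑ k ∈ K, v k * x k ≤ N v * A x
  exists_point : ∀ {v : ι → ℝ} {ε : ℝ}, (∀ k ∈ K, 0 ≤ v k) → 0 < ε →
    ∃ x : ι → ℝ, (∀ k ∈ K, 0 < x k) ∧ 0 < A x ∧ ∑ k ∈ K, v k * x k ≤ (N v + ε) * A x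

theorem IsNormalization.const_mul (h : IsNormalization K N) (a : ℝ) :
    IsNormalization K fun v => a * N v where
  dependsOn _ _ hvw := congrArg (a * ·) (h.dependsOn hvw)
  map_smul hr hv := by rw [h.map_smul hr hv, mul_left_comm]

theorem isNormalization_sum : IsNormalization K fun v => ∑ k ∈ K, v k where
  dependsOn _ _ h := sum_congr rfl h
  map_smul _ _ := by simp only [Pi.smul_apply, smul_eq_mul, mul_sum]

theorem IsConvexPolarPair.scale (h : IsConvexPolarPair K A N) {a : ℝ} (ha : 0 < a) :
    IsConvexPolarPair K (fun x => 1 / a * A x) (fun v => a * N v) := by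
  have hmul : ∀ v x, a * N v * (1 / a * A x) = N v * A x := fun v x => by field_simp
  refine ⟨h.toIsNormalization.const_mul a, fun hv hx => ?_, fun hx => ?_⟩
  · exact (h.sum_le_mul hv hx).trans_eq (hmul _ _).symm
  · obtain ⟨v, hv, hNv, hle⟩ := h.exists_weight hx
    exact ⟨v, hv, mul_pos ha hNv, (hmul _ _).trans_le hle⟩

namespace IsConcavePolarPair

theorem scale (h : IsConcavePolarPair K A N) {a : ℝ} (ha : 0 < a) :
    IsConcavePolarPair K (fun x => 1 / a * A x) (fun v => a * N v) := by
  have hmul : ∀ r x, a * r * (1 / a * A x) = r * A x := fun r x => by field_simp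
  refine ⟨h.toIsNormalization.const_mul a, fun hv hx => ?_, fun hx => ?_, fun {v ε} hv hε => ?_⟩
  · exact (hmul _ _).trans_le (h.mul_le_sum hv hx)
  · obtain ⟨v, hv, hNv, hle⟩ := h.exists_weight hx
    exact ⟨v, hv, mul_pos ha hNv, hle.trans_eq (hmul _ _).symm⟩
  · obtain ⟨x, hx, hAx, hle⟩ := h.exists_point hv (div_pos hε ha)
    refine ⟨x, hx, by positivity, hle.trans_eq ?_⟩
    field_simp

theorem of_continuousOn [Finite ι] (hN : IsNormalization K N)
    (hcont : ContinuousOn N {v | 0 ≤ v})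
    (hle : ∀ {v x : ι → ℝ}, (∀ k ∈ K, 0 ≤ v k) → (∀ k ∈ K, 0 ≤ x k) →
      N v * A x ≤ ∑ k ∈ K, v k * x k)
    (hweight : ∀ {x : ι → ℝ}, (∀ k ∈ K, 0 < x k) →
      ∃ v : ι → ℝ, (∀ k ∈ K, 0 ≤ v k) ∧ 0 < N v ∧ ∑ k ∈ K, v k * x k ≤ N v * A x)
    (hpoint : ∀ {v : ι → ℝ}, (∀ k ∈ K, 0 < v k) →
      ∃ x : ι → ℝ, (∀ k ∈ K, 0 < x k) ∧ 0 < A x ∧ ∑ k ∈ K, v k * x k ≤ N v * A x) :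
    IsConcavePolarPair K A N := by
  refine ⟨hN, hle, hweight, fun {v ε} hv hε => ?_⟩
  obtain ⟨η, hη, hshift⟩ := exists_shift_le_add hcont hN.dependsOn v hε
  obtain ⟨x, hx, hAx, hsum⟩ := hpoint (v := fun k => v k + η) fun k hk =>
    add_pos_of_nonneg_of_pos (hv k hk) hη
  refine ⟨x, hx, hAx, ?_⟩
  calc ∑ k ∈ K, v k * x k ≤ ∑ k ∈ K, (v k + η) * x k :=
        sum_le_sum fun k hk => mul_le_mul_of_nonneg_right (by linarith) (hx k hk).le
    _ ≤ N (fun k => v k + η) * A x := hsum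
    _ ≤ (N v + ε) * A x :=
        mul_le_mul_of_nonneg_right (hshift v fun k hk => ⟨hv k hk, le_rfl⟩) hAx.le

variable (h : IsConcavePolarPair K A N)
include h

theorem le_apply {x : ι → ℝ} (hx : ∀ k ∈ K, 0 < x k) {r : ℝ}
    (hr : ∀ v : ι → ℝ, (∀ k ∈ K, 0 ≤ v k) → N v * r ≤ ∑ k ∈ K, v k * x k) : r ≤ A x := by
  obtain ⟨v, hv, hNv, hle⟩ := h.exists_weight hx
  exact le_of_mul_le_mul_left ((hr v hv).trans hle) hNv

theorem apply_nonneg {x : ι → ℝ} (hx : ∀ k ∈ K, 0 < x k) : 0 ≤ A x :=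
  h.le_apply hx fun v hv => by
    rw [mul_zero]
    exact sum_nonneg fun k hk => mul_nonneg (hv k hk) (hx k hk).le

theorem apply_mono {x y : ι → ℝ} (hx : ∀ k ∈ K, 0 < x k) (hxy : ∀ k ∈ K, x k ≤ y k) :
    A x ≤ A y :=
  h.le_apply (fun k hk => (hx k hk).trans_le (hxy k hk)) fun _ hv =>
    (h.mul_le_sum hv fun k hk => (hx k hk).le).trans <|
      sum_le_sum fun k hk => mul_le_mul_of_nonneg_left (hxy k hk) (hv k hk)

theorem mul_le_apply_smul {x : ι → ℝ} (hx : ∀ k ∈ K, 0 < x k) {r : ℝ} (hr : 0 < r) :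
    r * A x ≤ A (r • x) :=
  h.le_apply (fun k hk => mul_pos hr (hx k hk)) fun v hv => by
    calc N v * (r * A x) = r * (N v * A x) := mul_left_comm _ _ _
      _ ≤ r * ∑ k ∈ K, v k * x k :=
          mul_le_mul_of_nonneg_left (h.mul_le_sum hv fun k hk => (hx k hk).le) hr.le
      _ = ∑ k ∈ K, v k * (r • x) k := by
          simp only [mul_sum, Pi.smul_apply, smul_eq_mul, mul_left_comm]

theorem concaveOn : ConcaveOn ℝ ((K : Set ι).pi fun _ => Set.Ioi 0) A := by
  have hconv : Convex ℝ ((K : Set ι).pi fun _ : ι => Set.Ioi (0 : ℝ)) :=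
    convex_pi fun _ _ => convex_Ioi 0
  refine ⟨hconv, fun x hx y hy a b ha hb hab => ?_⟩
  refine h.le_apply (hconv hx hy ha hb hab) fun v hv => ?_
  have hvx := h.mul_le_sum hv fun k hk => (hx k hk).le
  have hvy := h.mul_le_sum hv fun k hk => (hy k hk).le
  calc N v * (a • A x + b • A y) = a * (N v * A x) + b * (N v * A y) := by
        simp only [smul_eq_mul]; ring
    _ ≤ a * ∑ k ∈ K, v k * x k + b * ∑ k ∈ K, v k * y k := by gcongr
    _ = ∑ k ∈ K, v k * (a • x + b • y) k := by
        rw [mul_sum, mul_sum, ← sum_add_distrib]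
        refine sum_congr rfl fun k _ => ?_
        simp only [Pi.add_apply, Pi.smul_apply, smul_eq_mul]
        ring

theorem le_mul_of_forall_lt {c : ι → ℝ} (hc : ∀ k ∈ K, 0 ≤ c k) {s t u : ℝ} (ht : 0 < t)
    (hst : s < t)
    (hu : ∀ x : ι → ℝ, (∀ k ∈ K, 0 < x k) → s < A x → u < ∑ k ∈ K, c k * x k) :
    u ≤ N c * t := by
  refine le_of_forall_pos_le_add fun η hη => ?_
  obtain ⟨x, hx, hAx, hle⟩ := h.exists_point hc (div_pos hη ht)
  have hr : 0 < t / A x := div_pos ht hAx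
  have hsA : s < A ((t / A x) • x) :=
    hst.trans_le <| (div_mul_cancel₀ t hAx.ne').ge.trans (h.mul_le_apply_smul hx hr)
  calc u ≤ ∑ k ∈ K, c k * ((t / A x) • x) k :=
        (hu _ (fun k hk => mul_pos hr (hx k hk)) hsA).le
    _ = t / A x * ∑ k ∈ K, c k * x k := by
        simp only [mul_sum, Pi.smul_apply, smul_eq_mul, mul_left_comm]
    _ ≤ t / A x * ((N c + η / t) * A x) := mul_le_mul_of_nonneg_left hle hr.le
    _ = N c * t + η := by field_simp

theorem exists_lt_apply {s : ℝ} (hs : 0 ≤ s) : ∃ x : ι → ℝ, (∀ k ∈ K, 0 < x k) ∧ s < A x := by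
  obtain ⟨x, hx, hAx, -⟩ := h.exists_point (v := 0) (fun _ _ => le_rfl) one_pos
  have hr : 0 < (s + 1) / A x := by positivity
  refine ⟨((s + 1) / A x) • x, fun k hk => mul_pos hr (hx k hk), ?_⟩
  calc s < (s + 1) / A x * A x := by rw [div_mul_cancel₀ _ hAx.ne']; exact lt_add_one s
    _ ≤ A (((s + 1) / A x) • x) := h.mul_le_apply_smul hx hr

theorem isOpen_setOf_lt [Finite ι] (s : ℝ) : IsOpen {x | (∀ k ∈ K, 0 < x k) ∧ s < A x} := by
  cases nonempty_fintype ι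
  have hopen : IsOpen ((K : Set ι).pi fun _ : ι => Set.Ioi (0 : ℝ)) :=
    isOpen_set_pi K.finite_toSet fun _ _ => isOpen_Ioi
  have hcont := h.concaveOn.continuousOn hopen
  exact hcont.isOpen_inter_preimage hopen isOpen_Ioi

theorem exists_separating_weight [Finite ι] {F : Set (ι → ℝ)} (hF : Convex ℝ F) (h0 : 0 ∈ F)
    {ε s t : ℝ} (hε : 0 < ε) (hst : s < t)
    (hs : ∀ x ∈ F, A (fun k => x k + ε) ≤ s) :
    ∃ v : ι → ℝ, (∀ k ∈ K, 0 ≤ v k) ∧ 0 < N v ∧ ∀ x ∈ F, ∑ k ∈ K, v k * x k ≤ N v * t := by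
  have hs0 : 0 ≤ s := (h.apply_nonneg fun _ _ => hε.trans_eq (zero_add ε).symm).trans (hs 0 h0)
  have ht : 0 < t := hs0.trans_lt hst
  have hdisj : Disjoint {x | (∀ k ∈ K, 0 < x k) ∧ s < A x} ((· + fun _ => ε) '' F) := by
    rw [Set.disjoint_right]
    rintro - ⟨x, hx, rfl⟩ ⟨-, hlt⟩
    exact (hs x hx).not_gt hlt
  obtain ⟨c, u, hc, hU, hFu⟩ := exists_nonneg_weight_of_disjoint (h.isOpen_setOf_lt s)
    (h.concaveOn.convex_gt s) (h.exists_lt_apply hs0)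
    (fun x hx y hxy => ⟨fun k hk => (hx.1 k hk).trans_le (hxy k hk),
      hx.2.trans_le (h.apply_mono hx.1 hxy)⟩)
    (by simpa only [add_comm] using hF.translate fun _ => ε) hdisj
  have hu_le : u ≤ N c * t :=
    h.le_mul_of_forall_lt (fun k _ => hc k) ht hst fun x hx hxs => hU x ⟨hx, hxs⟩
  have hF_le : ∀ x ∈ F, ∑ k ∈ K, c k * x k + (∑ k ∈ K, c k) * ε ≤ u := fun x hx => by
    simpa only [Pi.add_apply, mul_add, sum_add_distrib, ← sum_mul] using hFu _ ⟨x, hx, rfl⟩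
  have hc_sum : 0 < ∑ k ∈ K, c k := by
    refine (sum_nonneg fun k _ => hc k).lt_of_ne' fun hc0 => ?_
    obtain ⟨x, hx⟩ := h.exists_lt_apply hs0
    have hux : u < ∑ k ∈ K, c k * x k := hU x hx
    have hcK := (sum_eq_zero_iff_of_nonneg fun k _ => hc k).1 hc0
    rw [sum_eq_zero fun k hk => by rw [hcK k hk, zero_mul]] at hux
    simpa [hc0] using (hF_le 0 h0).trans_lt hux
  have hu : 0 < u := (mul_pos hc_sum hε).trans_le (by simpa using hF_le 0 h0)
  refine ⟨c, fun k _ => hc k, pos_of_mul_pos_left (hu.trans_le hu_le) ht.le, fun x hx => ?_⟩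
  linarith [hF_le x hx, mul_pos hc_sum hε]

end IsConcavePolarPair

end PolarPairs

section PowerSums

variable {ι : Type*} {K : Finset ι} {p q : ℝ} {v x : ι → ℝ}

theorem phiSum_of_pos (hx : ∀ k ∈ K, 0 < x k) : phiSum p K x = (∑ k ∈ K, x k ^ p) ^ (1 / p) :=
  if_neg fun ⟨_, k, hk, h⟩ => (hx k hk).ne' h

theorem phiSum_of_nonneg (hp : 0 ≤ p) (x : ι → ℝ) :
    phiSum p K x = (∑ k ∈ K, x k ^ p) ^ (1 / p) :=
  if_neg fun h => h.1.not_ge hp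

theorem phiSum_eq_zero_of_neg (hp : p < 0) (hx : ∃ k ∈ K, x k = 0) : phiSum p K x = 0 :=
  if_pos ⟨hp, hx⟩

theorem phiSum_nonneg (hx : ∀ k ∈ K, 0 ≤ x k) : 0 ≤ phiSum p K x := by
  unfold phiSum
  split_ifs
  · exact le_rfl
  · exact Real.rpow_nonneg (sum_nonneg fun k hk => Real.rpow_nonneg (hx k hk) _) _

theorem sum_rpow_pos (hK : K.Nonempty) (hx : ∀ k ∈ K, 0 < x k) : 0 < ∑ k ∈ K, x k ^ p :=
  sum_pos (fun k hk => Real.rpow_pos_of_pos (hx k hk) _) hK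

theorem phiSum_pos (hK : K.Nonempty) (hx : ∀ k ∈ K, 0 < x k) : 0 < phiSum p K x := by
  rw [phiSum_of_pos hx]
  exact Real.rpow_pos_of_pos (sum_rpow_pos hK hx) _

theorem pos_or_exists_eq_zero (hx : ∀ k ∈ K, 0 ≤ x k) :
    (∀ k ∈ K, 0 < x k) ∨ ∃ k ∈ K, x k = 0 := by
  by_contra! h
  obtain ⟨⟨k, hk, hle⟩, hne⟩ := h
  exact hne k hk (hle.antisymm (hx k hk))

theorem phiSum_le_of_neg (hp : p < 0) (hx : ∀ k ∈ K, 0 ≤ x k) {j : ι} (hj : j ∈ K) :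
    phiSum p K x ≤ x j := by
  rcases pos_or_exists_eq_zero hx with hpos | hzero
  · rw [phiSum_of_pos hpos]
    have hle : x j ^ p ≤ ∑ k ∈ K, x k ^ p :=
      single_le_sum (f := fun k => x k ^ p) (fun k hk => Real.rpow_nonneg (hx k hk) _) hj
    calc (∑ k ∈ K, x k ^ p) ^ (1 / p) ≤ (x j ^ p) ^ (1 / p) :=
          Real.rpow_le_rpow_of_nonpos (Real.rpow_pos_of_pos (hpos j hj) _) hle (one_div_neg.2 hp).le
      _ = x j := by rw [one_div, Real.rpow_rpow_inv (hx j hj) hp.ne]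
  · rw [phiSum_eq_zero_of_neg hp hzero]
    exact hx j hj

theorem isNormalization_phiSum (hp : p ≠ 0) : IsNormalization K (phiSum p K) where
  dependsOn x y hxy := by
    have hzero : (∃ k ∈ K, x k = 0) ↔ ∃ k ∈ K, y k = 0 :=
      exists_congr fun k => and_congr_right fun hk => by rw [hxy k hk]
    have hsum : ∑ k ∈ K, x k ^ p = ∑ k ∈ K, y k ^ p := sum_congr rfl fun k hk => by rw [hxy k hk]
    simp only [phiSum, hzero, hsum]
  map_smul {r v} hr hv := by
    have hzero : (∃ k ∈ K, (r • v) k = 0) ↔ ∃ k ∈ K, v k = 0 := by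
      simp only [Pi.smul_apply, smul_eq_mul, mul_eq_zero, hr.ne', false_or]
    have hsum : ∑ k ∈ K, (r • v) k ^ p = r ^ p * ∑ k ∈ K, v k ^ p := by
      rw [mul_sum]
      exact sum_congr rfl fun k hk => Real.mul_rpow hr.le (hv k hk)
    have hroot : (r ^ p * ∑ k ∈ K, v k ^ p) ^ (1 / p) = r * (∑ k ∈ K, v k ^ p) ^ (1 / p) := by
      rw [Real.mul_rpow (Real.rpow_nonneg hr.le _)
        (sum_nonneg fun k hk => Real.rpow_nonneg (hv k hk) _), one_div, Real.rpow_rpow_inv hr.le hp]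
    simp only [phiSum, hzero, hsum, hroot, mul_ite, mul_zero]

theorem continuous_phiSum (hp : 0 < p) : Continuous (phiSum p K : (ι → ℝ) → ℝ) := by
  have hsum : Continuous fun x : ι → ℝ => ∑ k ∈ K, x k ^ p :=
    continuous_finsetSum _ fun k _ => (continuous_apply k).rpow_const fun _ => Or.inr hp.le
  exact (hsum.rpow_const fun _ => Or.inr (one_div_pos.2 hp).le).congr fun x =>
    (phiSum_of_nonneg hp.le x).symm

theorem continuousAt_phiSum (hK : K.Nonempty) (hx : ∀ k ∈ K, 0 < x k) :
    ContinuousAt (phiSum p K) x := by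
  have hpos : ∀ᶠ y : ι → ℝ in 𝓝 x, ∀ k ∈ K, 0 < y k :=
    K.eventually_all.2 fun k hk => (continuousAt_apply k x).eventually (lt_mem_nhds (hx k hk))
  have hsum : ContinuousAt (fun y : ι → ℝ => ∑ k ∈ K, y k ^ p) x :=
    tendsto_finsetSum _ fun k hk => (continuousAt_apply k x).rpow_const (Or.inl (hx k hk).ne')
  have hroot := hsum.rpow_const (p := 1 / p) (Or.inl (sum_rpow_pos hK hx).ne')
  refine hroot.congr ?_
  filter_upwards [hpos] with y hy using (phiSum_of_pos hy).symm

theorem continuousOn_phiSum (hp : p ≠ 0) (hK : K.Nonempty) :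
    ContinuousOn (phiSum p K) {x : ι → ℝ | 0 ≤ x} := by
  rcases hp.lt_or_gt with hneg | hpos
  · intro x hx
    rcases pos_or_exists_eq_zero (K := K) fun k _ => hx k with hxpos | ⟨j, hj, hxj⟩
    · exact (continuousAt_phiSum hK hxpos).continuousWithinAt
    · have hlim : Tendsto (fun y : ι → ℝ => y j) (𝓝[{x | 0 ≤ x}] x) (𝓝 0) :=
        hxj ▸ (continuous_apply j).continuousWithinAt
      rw [ContinuousWithinAt, phiSum_eq_zero_of_neg hneg ⟨j, hj, hxj⟩]
      refine squeeze_zero' ?_ ?_ hlim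
      · filter_upwards [self_mem_nhdsWithin] with y hy using phiSum_nonneg fun k _ => hy k
      · filter_upwards [self_mem_nhdsWithin] with y hy using
          phiSum_le_of_neg hneg (fun k _ => hy k) hj
  · exact (continuous_phiSum hpos).continuousOn

theorem Lp_mul_Lq_le_inner_of_neg (hp : p < 0) (hq : 0 < q) (hpq : 1 / p + 1 / q = 1)
    (hx : ∀ k ∈ K, 0 < x k) (hv : ∀ k ∈ K, 0 ≤ v k) :
    (∑ k ∈ K, x k ^ p) ^ (1 / p) * (∑ k ∈ K, v k ^ q) ^ (1 / q) ≤ ∑ k ∈ K, v k * x k := by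
  have hsum : 0 ≤ ∑ k ∈ K, v k * x k := sum_nonneg fun k hk => mul_nonneg (hv k hk) (hx k hk).le
  have hP : 0 ≤ ∑ k ∈ K, x k ^ p := sum_nonneg fun k hk => (Real.rpow_pos_of_pos (hx k hk) _).le
  have hQ : 0 ≤ ∑ k ∈ K, v k ^ q := sum_nonneg fun k hk => Real.rpow_nonneg (hv k hk) _
  have hconj : Real.HolderTriple 1 (-p) q :=
    ⟨by rw [inv_one, inv_neg, ← one_div, ← one_div]; linarith, one_pos, neg_pos.2 hp⟩
  have hsplit : ∑ k ∈ K, v k ^ q = ∑ k ∈ K, (v k * x k * (x k)⁻¹) ^ q :=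
    sum_congr rfl fun k hk => by rw [mul_inv_cancel_right₀ (hx k hk).ne']
  have hholder : ∑ k ∈ K, v k ^ q ≤ (∑ k ∈ K, v k * x k) ^ q * (∑ k ∈ K, x k ^ p) ^ (q / -p) := by
    rw [hsplit]
    refine (Real.Lr_rpow_le_Lp_mul_Lq_of_nonneg K hconj
      (fun k hk => mul_nonneg (hv k hk) (hx k hk).le)
      fun k hk => (inv_pos.2 (hx k hk)).le).trans_eq ?_
    simp only [Real.rpow_one, div_one]
    congr 2
    exact sum_congr rfl fun k hk => by
      rw [Real.inv_rpow (hx k hk).le, Real.rpow_neg (hx k hk).le, inv_inv]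
  have hroot : (∑ k ∈ K, v k ^ q) ^ (1 / q) ≤
      (∑ k ∈ K, v k * x k) * ((∑ k ∈ K, x k ^ p) ^ (1 / p))⁻¹ := by
    refine (Real.rpow_le_rpow hQ hholder (one_div_pos.2 hq).le).trans_eq ?_
    rw [Real.mul_rpow (Real.rpow_nonneg hsum _) (Real.rpow_nonneg hP _), one_div,
      Real.rpow_rpow_inv hsum hq.ne', ← Real.rpow_mul hP, ← Real.rpow_neg hP]
    congr 2
    field_simp
  calc (∑ k ∈ K, x k ^ p) ^ (1 / p) * (∑ k ∈ K, v k ^ q) ^ (1 / q)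
      ≤ (∑ k ∈ K, x k ^ p) ^ (1 / p) *
          ((∑ k ∈ K, v k * x k) * ((∑ k ∈ K, x k ^ p) ^ (1 / p))⁻¹) :=
        mul_le_mul_of_nonneg_left hroot (Real.rpow_nonneg hP _)
    _ = (∑ k ∈ K, v k * x k) *
          ((∑ k ∈ K, x k ^ p) ^ (1 / p) * ((∑ k ∈ K, x k ^ p) ^ (1 / p))⁻¹) := by ring
    _ ≤ ∑ k ∈ K, v k * x k := mul_le_of_le_one_right hsum mul_inv_le_one

theorem phiSum_mul_phiSum_le_of_neg (hp : p < 0) (hq : 0 < q) (hpq : 1 / p + 1 / q = 1)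
    (hv : ∀ k ∈ K, 0 ≤ v k) (hx : ∀ k ∈ K, 0 ≤ x k) :
    phiSum p K x * phiSum q K v ≤ ∑ k ∈ K, v k * x k := by
  rcases pos_or_exists_eq_zero hx with hpos | hzero
  · rw [phiSum_of_pos hpos, phiSum_of_nonneg hq.le]
    exact Lp_mul_Lq_le_inner_of_neg hp hq hpq hpos hv
  · rw [phiSum_eq_zero_of_neg hp hzero, zero_mul]
    exact sum_nonneg fun k hk => mul_nonneg (hv k hk) (hx k hk)

theorem phiSum_mul_phiSum_le (hp : p < 1) (hp0 : p ≠ 0) (hpq : 1 / p + 1 / q = 1)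
    (hv : ∀ k ∈ K, 0 ≤ v k) (hx : ∀ k ∈ K, 0 ≤ x k) :
    phiSum q K v * phiSum p K x ≤ ∑ k ∈ K, v k * x k := by
  rcases hp0.lt_or_gt with hneg | hpos
  · have hq : 0 < q := one_div_pos.1 (by linarith [one_div_neg.2 hneg])
    rw [mul_comm]
    exact phiSum_mul_phiSum_le_of_neg hneg hq hpq hv hx
  · have hq : q < 0 := one_div_neg.1 (by linarith [(one_lt_div hpos).2 hp])
    simpa only [mul_comm] using
      phiSum_mul_phiSum_le_of_neg hq hpos ((add_comm _ _).trans hpq) hx hv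

theorem sum_rpow_sub_one_mul (hp : p ≠ 0) (hq : q ≠ 0) (hpq : 1 / p + 1 / q = 1)
    (hx : ∀ k ∈ K, 0 ≤ x k) :
    ∑ k ∈ K, x k ^ (p - 1) * x k =
      (∑ k ∈ K, (x k ^ (p - 1)) ^ q) ^ (1 / q) * (∑ k ∈ K, x k ^ p) ^ (1 / p) := by
  have hexp : (p - 1) * q = p := by field_simp at hpq; linarith
  have hmul : ∀ k ∈ K, x k ^ (p - 1) * x k = x k ^ p := fun k hk => by
    rw [← Real.rpow_add_one' (hx k hk) (by simpa using hp), sub_add_cancel]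
  have hpow : ∀ k ∈ K, (x k ^ (p - 1)) ^ q = x k ^ p := fun k hk => by
    rw [← Real.rpow_mul (hx k hk), hexp]
  have hsum : 0 ≤ ∑ k ∈ K, x k ^ p := sum_nonneg fun k hk => Real.rpow_nonneg (hx k hk) _
  have hqp : 1 / q + 1 / p = 1 := (add_comm _ _).trans hpq
  have hne : 1 / q + 1 / p ≠ 0 := by rw [hqp]; exact one_ne_zero
  rw [sum_congr rfl hmul, sum_congr rfl hpow, ← Real.rpow_add' hsum hne, hqp, Real.rpow_one]

theorem sum_rpow_sub_one_mul_eq_phiSum (hp : p ≠ 0) (hq : q ≠ 0) (hpq : 1 / p + 1 / q = 1)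
    (hx : ∀ k ∈ K, 0 < x k) :
    ∑ k ∈ K, x k ^ (p - 1) * x k = phiSum q K (fun k => x k ^ (p - 1)) * phiSum p K x := by
  rw [phiSum_of_pos hx, phiSum_of_pos fun k hk => Real.rpow_pos_of_pos (hx k hk) _,
    sum_rpow_sub_one_mul hp hq hpq fun k hk => (hx k hk).le]

end PowerSums

section Examples

variable {ι : Type*} {K : Finset ι} {p q : ℝ}

theorem isConvexPolarPair_phiSum (hK : K.Nonempty) (hp : 1 < p) (hpq : 1 / p + 1 / q = 1) :
    IsConvexPolarPair K (phiSum p K) (phiSum q K) := by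
  have hconj : p.HolderConjugate q := Real.holderConjugate_iff.2 ⟨hp, by simpa using hpq⟩
  refine ⟨isNormalization_phiSum hconj.symm.ne_zero, fun {v x} hv hx => ?_, fun {x} hx => ?_⟩
  · rw [mul_comm, phiSum_of_nonneg hconj.nonneg, phiSum_of_nonneg hconj.symm.nonneg]
    simpa only [mul_comm] using Real.inner_le_Lp_mul_Lq_of_nonneg K hconj hx hv
  · by_cases hx0 : ∀ k ∈ K, x k = 0
    · refine ⟨1, fun _ _ => zero_le_one, phiSum_pos hK fun _ _ => one_pos, ?_⟩
      have hsum : ∑ k ∈ K, x k ^ p = 0 :=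
        sum_eq_zero fun k hk => by rw [hx0 k hk, Real.zero_rpow hconj.ne_zero]
      rw [phiSum_of_nonneg hconj.nonneg x, hsum, Real.zero_rpow hconj.one_div_ne_zero, mul_zero]
      exact sum_nonneg fun k hk => mul_nonneg zero_le_one (hx k hk)
    · push Not at hx0
      obtain ⟨j, hj, hxj⟩ := hx0
      refine ⟨fun k => x k ^ (p - 1), fun k hk => Real.rpow_nonneg (hx k hk) _, ?_, ?_⟩
      · have hxj_pos : 0 < (x j ^ (p - 1)) ^ q :=
          Real.rpow_pos_of_pos (Real.rpow_pos_of_pos ((hx j hj).lt_of_ne' hxj) _) _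
        rw [phiSum_of_nonneg hconj.symm.nonneg]
        exact Real.rpow_pos_of_pos (sum_pos' (fun k hk =>
          Real.rpow_nonneg (Real.rpow_nonneg (hx k hk) _) _) ⟨j, hj, hxj_pos⟩) _
      · rw [phiSum_of_nonneg hconj.nonneg, phiSum_of_nonneg hconj.symm.nonneg,
          sum_rpow_sub_one_mul hconj.ne_zero hconj.symm.ne_zero hpq hx]

theorem isConcavePolarPair_phiSum [Finite ι] (hK : K.Nonempty) (hp : p < 1) (hp0 : p ≠ 0)
    (hpq : 1 / p + 1 / q = 1) : IsConcavePolarPair K (phiSum p K) (phiSum q K) := by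
  have hq0 : q ≠ 0 := by rintro rfl; simp [hp.ne] at hpq
  have hrpow : ∀ {v : ι → ℝ} (r : ℝ), (∀ k ∈ K, 0 < v k) → ∀ k ∈ K, 0 < v k ^ r :=
    fun r hv k hk => Real.rpow_pos_of_pos (hv k hk) r
  refine .of_continuousOn (isNormalization_phiSum hq0) (continuousOn_phiSum hq0 hK)
    (phiSum_mul_phiSum_le hp hp0 hpq) (fun {x} hx => ?_) fun {v} hv => ?_
  · exact ⟨fun k => x k ^ (p - 1), fun k hk => (hrpow _ hx k hk).le, phiSum_pos hK (hrpow _ hx),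
      (sum_rpow_sub_one_mul_eq_phiSum hp0 hq0 hpq hx).le⟩
  · refine ⟨fun k => v k ^ (q - 1), hrpow _ hv, phiSum_pos hK (hrpow _ hv), ?_⟩
    simpa only [mul_comm] using
      (sum_rpow_sub_one_mul_eq_phiSum hq0 hp0 ((add_comm _ _).trans hpq) hv).le

theorem isConvexPolarPair_sum_sup' (hK : K.Nonempty) :
    IsConvexPolarPair K (fun x => ∑ k ∈ K, x k) fun v => K.sup' hK v := by
  refine ⟨⟨fun v w h => sup'_congr hK rfl h, fun hr _ => ?_⟩, fun {v x} _ hx => ?_,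
    fun {x} _ => ?_⟩
  · exact (map_finset_sup' (OrderIso.mulLeft₀ _ hr) hK _).symm
  · rw [mul_sum]
    exact sum_le_sum fun k hk => mul_le_mul_of_nonneg_right (le_sup' v hk) (hx k hk)
  · refine ⟨1, fun _ _ => zero_le_one, ?_, ?_⟩
    · simp
    · simp

theorem isConvexPolarPair_sup'_sum (hK : K.Nonempty) :
    IsConvexPolarPair K (fun x => K.sup' hK x) fun v => ∑ k ∈ K, v k := by
  classical
  refine ⟨isNormalization_sum, fun {v x} hv _ => ?_, fun {x} _ => ?_⟩
  · rw [sum_mul]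
    exact sum_le_sum fun k hk => mul_le_mul_of_nonneg_left (le_sup' x hk) (hv k hk)
  · obtain ⟨j, hj, hmax⟩ := exists_mem_eq_sup' hK x
    exact ⟨Pi.single j 1, fun k _ => (Pi.single_nonneg.2 zero_le_one : (0 : ι → ℝ) ≤ _) k,
      by simp [hj], by simp [hj, hmax, Pi.single_apply]⟩

theorem isConcavePolarPair_inf'_sum (hK : K.Nonempty) :
    IsConcavePolarPair K (fun x => K.inf' hK x) fun v => ∑ k ∈ K, v k := by
  classical
  refine ⟨isNormalization_sum, fun {v x} hv _ => ?_, fun {x} _ => ?_, fun {v ε} _ hε => ?_⟩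
  · rw [sum_mul]
    exact sum_le_sum fun k hk => mul_le_mul_of_nonneg_left (inf'_le x hk) (hv k hk)
  · obtain ⟨j, hj, hmin⟩ := exists_mem_eq_inf' hK x
    exact ⟨Pi.single j 1, fun k _ => (Pi.single_nonneg.2 zero_le_one : (0 : ι → ℝ) ≤ _) k,
      by simp [hj], by simp [hj, hmin, Pi.single_apply]⟩
  · exact ⟨1, fun _ _ => one_pos, by simp, by simp [hε.le]⟩

theorem prod_rpow_pos {v : ι → ℝ} {r : ℝ} (hv : ∀ k ∈ K, 0 < v k) : 0 < ∏ k ∈ K, v k ^ r :=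
  prod_pos fun k hk => Real.rpow_pos_of_pos (hv k hk) _

theorem prod_inv_rpow_mul_prod_rpow {v : ι → ℝ} {r : ℝ} (hv : ∀ k ∈ K, 0 < v k) :
    (∏ k ∈ K, (v k)⁻¹ ^ r) * ∏ k ∈ K, v k ^ r = 1 := by
  rw [← prod_mul_distrib]
  refine prod_eq_one fun k hk => ?_
  rw [Real.inv_rpow (hv k hk).le, inv_mul_cancel₀ (Real.rpow_pos_of_pos (hv k hk) _).ne']

theorem isNormalization_geomMean (hK : K.Nonempty) :
    IsNormalization K fun v => ∏ k ∈ K, v k ^ (1 / (#K : ℝ)) where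
  dependsOn _ _ h := prod_congr rfl fun k hk => by rw [h k hk]
  map_smul {r v} hr hv := by
    have hcard : (#K : ℝ) ≠ 0 := Nat.cast_ne_zero.2 hK.card_ne_zero
    calc ∏ k ∈ K, (r • v) k ^ (1 / (#K : ℝ))
        = ∏ k ∈ K, r ^ (1 / (#K : ℝ)) * v k ^ (1 / (#K : ℝ)) :=
          prod_congr rfl fun k hk => Real.mul_rpow hr.le (hv k hk)
      _ = r * ∏ k ∈ K, v k ^ (1 / (#K : ℝ)) := by
          rw [prod_mul_distrib, prod_const, ← Real.rpow_mul_natCast hr.le, one_div_mul_cancel hcard,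
            Real.rpow_one]

theorem continuous_geomMean : Continuous fun v : ι → ℝ => ∏ k ∈ K, v k ^ (1 / (#K : ℝ)) :=
  continuous_finsetProd _ fun k _ => (continuous_apply k).rpow_const fun _ =>
    Or.inr (one_div_nonneg.2 (Nat.cast_nonneg _))

theorem card_mul_geomMean_mul_geomMean_le (hK : K.Nonempty) {v x : ι → ℝ}
    (hv : ∀ k ∈ K, 0 ≤ v k) (hx : ∀ k ∈ K, 0 ≤ x k) :
    #K * (∏ k ∈ K, v k ^ (1 / (#K : ℝ))) * ∏ k ∈ K, x k ^ (1 / (#K : ℝ)) ≤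
      ∑ k ∈ K, v k * x k := by
  have hcard : 0 < (#K : ℝ) := Nat.cast_pos.2 hK.card_pos
  have hweights : ∑ _k ∈ K, 1 / (#K : ℝ) = 1 := by
    rw [sum_const, nsmul_eq_mul, mul_one_div_cancel hcard.ne']
  calc #K * (∏ k ∈ K, v k ^ (1 / (#K : ℝ))) * ∏ k ∈ K, x k ^ (1 / (#K : ℝ))
      = #K * ∏ k ∈ K, (v k * x k) ^ (1 / (#K : ℝ)) := by
        rw [mul_assoc, ← prod_mul_distrib]
        exact congrArg _ (prod_congr rfl fun k hk => (Real.mul_rpow (hv k hk) (hx k hk)).symm)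
    _ ≤ #K * ∑ k ∈ K, 1 / (#K : ℝ) * (v k * x k) :=
        mul_le_mul_of_nonneg_left (Real.geom_mean_le_arith_mean_weighted K _ _
          (fun _ _ => (one_div_pos.2 hcard).le) hweights fun k hk =>
            mul_nonneg (hv k hk) (hx k hk)) hcard.le
    _ = ∑ k ∈ K, v k * x k := by rw [← mul_sum, ← mul_assoc, mul_one_div_cancel hcard.ne', one_mul]

theorem isConcavePolarPair_geomMean [Finite ι] (hK : K.Nonempty) :
    IsConcavePolarPair K (fun x => ∏ k ∈ K, x k ^ (1 / (#K : ℝ)))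
      fun v => #K * ∏ k ∈ K, v k ^ (1 / (#K : ℝ)) := by
  have hcard : 0 < (#K : ℝ) := Nat.cast_pos.2 hK.card_pos
  have hinv : ∀ {v : ι → ℝ}, (∀ k ∈ K, 0 < v k) → ∀ k ∈ K, 0 < (v k)⁻¹ :=
    fun hv k hk => inv_pos.2 (hv k hk)
  refine .of_continuousOn ((isNormalization_geomMean hK).const_mul _)
    (continuous_const.mul continuous_geomMean).continuousOn
    (card_mul_geomMean_mul_geomMean_le hK) (fun {x} hx => ?_) fun {v} hv => ?_
  · refine ⟨fun k => (x k)⁻¹, fun k hk => (hinv hx k hk).le,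
      mul_pos hcard (prod_rpow_pos (hinv hx)), ?_⟩
    rw [mul_assoc, prod_inv_rpow_mul_prod_rpow hx, mul_one,
      sum_congr rfl fun k hk => inv_mul_cancel₀ (hx k hk).ne', sum_const, nsmul_eq_mul, mul_one]
  · refine ⟨fun k => (v k)⁻¹, hinv hv, prod_rpow_pos (hinv hv), ?_⟩
    rw [mul_right_comm, mul_assoc, prod_inv_rpow_mul_prod_rpow hv, mul_one,
      sum_congr rfl fun k hk => mul_inv_cancel₀ (hv k hk).ne', sum_const, nsmul_eq_mul, mul_one]

end Examples

section Slacks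

variable {m n : ℕ} {T : Set (Netput m n)} {z g : Netput m n} {A : Netput m n → ℝ}

theorem mem_supp {k : Fin m ⊕ Fin n} : k ∈ supp g ↔ g k ≠ 0 := by simp [supp]

theorem apply_eq_zero_of_notMem_supp {k : Fin m ⊕ Fin n} (hk : k ∉ supp g) : g k = 0 :=
  not_not.1 (mem_supp.not.1 hk)

theorem pos_of_mem_supp (hg : 0 ≤ g) {k : Fin m ⊕ Fin n} (hk : k ∈ supp g) : 0 < g k :=
  (hg k).lt_of_ne' (mem_supp.1 hk)

theorem suppCard_pos (hg : g ≠ 0) : 0 < suppCard g :=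
  Nat.cast_pos.2 (supp_nonempty hg).card_pos

/-- The slack vectors `δ ≥ 0` along the direction `g` that are feasible from `z`. Their coordinates
outside the support of `g` are irrelevant, and unrestricted. -/
def slackSet (T : Set (Netput m n)) (z g : Netput m n) : Set (Netput m n) :=
  {δ | 0 ≤ δ ∧ z + δ * g ∈ T}

theorem zero_mem_slackSet (hz : z ∈ T) : 0 ∈ slackSet T z g :=
  ⟨le_rfl, by rwa [zero_mul, add_zero]⟩

theorem convex_slackSet (hT : Convex ℝ T) : Convex ℝ (slackSet T z g) := by
  rintro x ⟨hx, hxT⟩ y ⟨hy, hyT⟩ a b ha hb hab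
  refine ⟨add_nonneg (smul_nonneg ha hx) (smul_nonneg hb hy), ?_⟩
  convert hT hxT hyT ha hb hab using 1
  ext k
  simp only [Pi.add_apply, Pi.mul_apply, Pi.smul_apply, smul_eq_mul]
  linear_combination -z k * hab

theorem exists_slackSet_le (hbdd : Bornology.IsBounded (dominating T z)) (hg : 0 ≤ g) :
    ∃ b : Netput m n, ∀ δ ∈ slackSet T z g, ∀ k ∈ supp g, δ k ≤ b k := by
  obtain ⟨R, hR⟩ := hbdd.exists_norm_le
  refine ⟨fun k => (R - z k) / g k, fun δ hδ k hk => ?_⟩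
  have hmem : z + δ * g ∈ dominating T z := ⟨hδ.2, le_add_of_nonneg_right (mul_nonneg hδ.1 hg)⟩
  have hle : z k + δ k * g k ≤ R :=
    (le_abs_self _).trans ((norm_le_pi_norm (z + δ * g) k).trans (hR _ hmem))
  rw [le_div_iff₀ (pos_of_mem_supp hg hk)]
  linarith

theorem exists_shift_le_add_of_mem_slackSet (hbdd : Bornology.IsBounded (dominating T z))
    (hg : 0 ≤ g) (hA : ContinuousOn A {x | 0 ≤ x}) (hAK : DependsOn A (supp g)) {η : ℝ}
    (hη : 0 < η) : ∃ ε > 0, ∀ δ ∈ slackSet T z g, A (fun k => δ k + ε) ≤ A δ + η := by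
  obtain ⟨b, hb⟩ := exists_slackSet_le hbdd hg
  obtain ⟨ε, hε, hshift⟩ := exists_shift_le_add hA hAK b hη
  exact ⟨ε, hε, fun δ hδ => hshift δ fun k hk => ⟨hδ.1 k, hb δ hδ k hk⟩⟩

theorem dotProduct_add_mul (w δ : Netput m n) :
    w ⬝ᵥ (z + δ * g) = ∑ k ∈ supp g, g k * w k * δ k + w ⬝ᵥ z := by
  rw [dotProduct_add, add_comm, dotProduct, sum_subset (subset_univ (supp g))]
  · exact congrArg (· + _) (sum_congr rfl fun k _ => by rw [Pi.mul_apply]; ring)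
  · intro k _ hk
    rw [apply_eq_zero_of_notMem_supp hk, zero_mul, zero_mul]

theorem dotProduct_eq_sum_supp (w : Netput m n) : w ⬝ᵥ g = ∑ k ∈ supp g, g k * w k := by
  simpa using dotProduct_add_mul (z := 0) (g := g) w 1

theorem slackDist_eq_biSup_slackSet (hz : z ∈ T) (hg : g ≠ 0) :
    slackDist A T z g = ⨆ δ ∈ slackSet T z g, (A δ : EReal) := by
  simp only [slackDist, hz, hg, not_true_eq_false, if_false, slackSet, Set.mem_ofPred_eq, iSup_and]

theorem coe_le_slackDist (hz : z ∈ T) (hg : g ≠ 0) {δ : Netput m n} (hδ : δ ∈ slackSet T z g) :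
    (A δ : EReal) ≤ slackDist A T z g := by
  rw [slackDist_eq_biSup_slackSet hz hg]
  exact le_iSup₂_of_le δ hδ le_rfl

theorem slackDist_le_iff (hz : z ∈ T) (hg : g ≠ 0) {B : EReal} :
    slackDist A T z g ≤ B ↔ ∀ δ ∈ slackSet T z g, (A δ : EReal) ≤ B := by
  rw [slackDist_eq_biSup_slackSet hz hg, iSup₂_le_iff]

end Slacks

section Profit

variable {m n : ℕ} {T : Set (Netput m n)} {z g w : Netput m n}

theorem exists_slack_eq (hg : 0 ≤ g) {u : Netput m n} (hu : z ≤ u)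
    (huz : ∀ k ∉ supp g, u k = z k) : ∃ δ : Netput m n, 0 ≤ δ ∧ z + δ * g = u := by
  refine ⟨fun k => (u k - z k) / g k, fun k => div_nonneg (sub_nonneg.2 (hu k)) (hg k), ?_⟩
  ext k
  by_cases hk : k ∈ supp g
  · simp [div_mul_cancel₀ _ (mem_supp.1 hk)]
  · simp [apply_eq_zero_of_notMem_supp hk, huz k hk]

theorem profitDir_sub_le_iff (hg : 0 ≤ g) {B : EReal} :
    profitDir T z g w - ((w ⬝ᵥ z : ℝ) : EReal) ≤ B ↔
      ∀ δ ∈ slackSet T z g, ((∑ k ∈ supp g, g k * w k * δ k : ℝ) : EReal) ≤ B := by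
  have hvalue : ∀ δ : Netput m n, ((w ⬝ᵥ (z + δ * g) : ℝ) : EReal) ≤ B + ((w ⬝ᵥ z : ℝ) : EReal) ↔
      ((∑ k ∈ supp g, g k * w k * δ k : ℝ) : EReal) ≤ B := fun δ => by
    rw [← EReal.sub_le_iff_le_add (Or.inl (EReal.coe_ne_bot _)) (Or.inl (EReal.coe_ne_top _)),
      ← EReal.coe_sub, dotProduct_add_mul, add_sub_cancel_right]
  rw [EReal.sub_le_iff_le_add (Or.inl (EReal.coe_ne_bot _)) (Or.inl (EReal.coe_ne_top _))]
  simp only [profitDir, iSup_le_iff]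
  constructor
  · intro h δ hδ
    refine (hvalue δ).1 (h _ ⟨hδ.2, le_add_of_nonneg_right (mul_nonneg hδ.1 hg)⟩ fun k hk => ?_)
    rw [Pi.add_apply, Pi.mul_apply, apply_eq_zero_of_notMem_supp hk, mul_zero, add_zero]
  · intro h u hu huz
    obtain ⟨δ, hδ, rfl⟩ := exists_slack_eq hg hu.2 huz
    exact (hvalue δ).2 (h δ ⟨hδ, hu.1⟩)

theorem profitDir_le_profit : profitDir T z g w ≤ profit T z w :=
  iSup₂_mono fun _ _ => iSup_le fun _ => le_rfl

theorem profit_eq_profitDir (hT : IsLowerSet T) (hw : ∀ k ∉ supp g, w k = 0) :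
    profit T z w = profitDir T z g w := by
  classical
  refine le_antisymm (iSup₂_le fun u hu => ?_) profitDir_le_profit
  set u' : Netput m n := (supp g).piecewise u z
  have hu'u : u' ≤ u := piecewise_le_of_le_of_le (supp g) le_rfl hu.2
  have hzu' : z ≤ u' := le_piecewise_of_le_of_le (supp g) hu.2 le_rfl
  have hdot : w ⬝ᵥ u = w ⬝ᵥ u' := by
    refine sum_congr rfl fun k _ => ?_
    by_cases hk : k ∈ supp g
    · exact congrArg (w k * ·) (piecewise_eq_of_mem _ _ _ hk).symm
    · rw [hw k hk, zero_mul, zero_mul]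
  rw [hdot]
  exact le_iSup₂_of_le u' ⟨hT hu'u hu.1, hzu'⟩ <|
    le_iSup_of_le (fun k hk => piecewise_eq_of_notMem _ _ _ hk) le_rfl

end Profit

section Duality

variable {m n : ℕ} {T : Set (Netput m n)} {z g : Netput m n} {A N : Netput m n → ℝ}

theorem IsNormalization.exists_price (hN : IsNormalization (supp g) N) (hg : 0 ≤ g)
    {v : Netput m n} (hv : ∀ k ∈ supp g, 0 ≤ v k) (hNv : 0 < N v) :
    ∃ w : Netput m n, 0 ≤ w ∧ (∀ k ∉ supp g, w k = 0) ∧ N (fun k => g k * w k) = 1 ∧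
      ∀ x : Netput m n, N v * ∑ k ∈ supp g, g k * w k * x k = ∑ k ∈ supp g, v k * x k := by
  have hgw : ∀ k ∈ supp g, g k * ((N v)⁻¹ * v k / g k) = (N v)⁻¹ * v k :=
    fun k hk => mul_div_cancel₀ _ (mem_supp.1 hk)
  refine ⟨fun k => (N v)⁻¹ * v k / g k, fun k => ?_, fun k hk => ?_, ?_, fun x => ?_⟩
  · by_cases hk : k ∈ supp g
    · exact div_nonneg (mul_nonneg (inv_pos.2 hNv).le (hv k hk)) (hg k)
    · simp [apply_eq_zero_of_notMem_supp hk]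
  · simp [apply_eq_zero_of_notMem_supp hk]
  · calc N (fun k => g k * ((N v)⁻¹ * v k / g k)) = N ((N v)⁻¹ • v) := hN.dependsOn hgw
      _ = 1 := by rw [hN.map_smul (inv_pos.2 hNv) hv, inv_mul_cancel₀ hNv.ne']
  · rw [mul_sum]
    refine sum_congr rfl fun k hk => ?_
    rw [hgw k hk, ← mul_assoc, mul_inv_cancel_left₀ hNv.ne']

theorem slackDist_eq_iSup (h : IsConvexPolarPair (supp g) A N) (hz : z ∈ T) (hg : 0 ≤ g)
    (hg0 : g ≠ 0) :
    slackDist A T z g =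
      ⨆ (w : Netput m n) (_ : 0 ≤ w) (_ : N (fun k => g k * w k) = 1),
        (profitDir T z g w - ((w ⬝ᵥ z : ℝ) : EReal)) := by
  refine le_antisymm ((slackDist_le_iff hz hg0).2 fun δ hδ => ?_)
    (iSup_le fun w => iSup₂_le fun hw hNw => (profitDir_sub_le_iff hg).2 fun δ hδ => ?_)
  · obtain ⟨v, hv, hNv, hle⟩ := h.exists_weight fun k _ => hδ.1 k
    obtain ⟨w, hw, -, hNw, hsum⟩ := h.exists_price hg hv hNv
    have hA : A δ ≤ ∑ k ∈ supp g, g k * w k * δ k :=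
      le_of_mul_le_mul_left (hle.trans_eq (hsum δ).symm) hNv
    exact le_iSup_of_le w <| le_iSup₂_of_le hw hNw <|
      (EReal.coe_le_coe_iff.2 hA).trans ((profitDir_sub_le_iff hg).1 le_rfl δ hδ)
  · have hA := h.sum_le_mul (v := fun k => g k * w k) (x := δ)
      (fun k _ => mul_nonneg (hg k) (hw k)) fun k _ => hδ.1 k
    rw [hNw, one_mul] at hA
    exact (EReal.coe_le_coe_iff.2 hA).trans (coe_le_slackDist hz hg0 hδ)

theorem slackDist_le_profit_sub (h : IsConcavePolarPair (supp g) A N) (hz : z ∈ T) (hg : 0 ≤ g)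
    (hg0 : g ≠ 0) {w : Netput m n} (hw : 0 ≤ w) (hNw : N (fun k => g k * w k) = 1) :
    slackDist A T z g ≤ profit T z w - ((w ⬝ᵥ z : ℝ) : EReal) := by
  refine (slackDist_le_iff hz hg0).2 fun δ hδ => ?_
  have hA := h.mul_le_sum (v := fun k => g k * w k) (x := δ)
    (fun k _ => mul_nonneg (hg k) (hw k)) fun k _ => hδ.1 k
  rw [hNw, one_mul] at hA
  calc (A δ : EReal) ≤ ((∑ k ∈ supp g, g k * w k * δ k : ℝ) : EReal) := EReal.coe_le_coe_iff.2 hA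
    _ ≤ profitDir T z g w - ((w ⬝ᵥ z : ℝ) : EReal) := (profitDir_sub_le_iff hg).1 le_rfl δ hδ
    _ ≤ profit T z w - ((w ⬝ᵥ z : ℝ) : EReal) := EReal.sub_le_sub profitDir_le_profit le_rfl

theorem exists_price_profit_sub_le (h : IsConcavePolarPair (supp g) A N) (hT : IsLowerSet T)
    (hconv : Convex ℝ T) (hz : z ∈ T) (hg : 0 ≤ g) {ε s t : ℝ} (hε : 0 < ε) (hst : s < t)
    (hs : ∀ δ ∈ slackSet T z g, A (fun k => δ k + ε) ≤ s) :
    ∃ w : Netput m n, 0 ≤ w ∧ N (fun k => g k * w k) = 1 ∧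
      profit T z w - ((w ⬝ᵥ z : ℝ) : EReal) ≤ (t : EReal) := by
  obtain ⟨v, hv, hNv, hle⟩ :=
    h.exists_separating_weight (convex_slackSet hconv) (zero_mem_slackSet hz) hε hst hs
  obtain ⟨w, hw, hw0, hNw, hsum⟩ := h.exists_price hg hv hNv
  refine ⟨w, hw, hNw, ?_⟩
  rw [profit_eq_profitDir hT hw0]
  exact (profitDir_sub_le_iff hg).2 fun δ hδ => EReal.coe_le_coe_iff.2 <|
    le_of_mul_le_mul_left ((hsum δ).trans_le (hle δ hδ)) hNv

theorem slackDist_eq_iInf (h : IsConcavePolarPair (supp g) A N) (hT : IsLowerSet T)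
    (hconv : Convex ℝ T) (hz : z ∈ T) (hg : 0 ≤ g) (hg0 : g ≠ 0)
    (hshift : ∀ η > 0, ∃ ε > 0, ∀ δ ∈ slackSet T z g, A (fun k => δ k + ε) ≤ A δ + η) :
    slackDist A T z g =
      ⨅ (w : Netput m n) (_ : 0 ≤ w) (_ : N (fun k => g k * w k) = 1),
        (profit T z w - ((w ⬝ᵥ z : ℝ) : EReal)) := by
  refine le_antisymm (le_iInf fun w => le_iInf₂ fun hw hNw =>
    slackDist_le_profit_sub h hz hg hg0 hw hNw) (EReal.le_of_forall_lt_iff_le.mp fun t ht => ?_)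
  obtain ⟨r, hr, hrt⟩ := EReal.lt_iff_exists_real_btwn.mp ht
  obtain ⟨s, hrs, hst⟩ := exists_between (EReal.coe_lt_coe_iff.1 hrt)
  obtain ⟨ε, hε, hAε⟩ := hshift (s - r) (sub_pos.2 hrs)
  have hs : ∀ δ ∈ slackSet T z g, A (fun k => δ k + ε) ≤ s := fun δ hδ => by
    have hAr : A δ ≤ r := EReal.coe_le_coe_iff.1 ((coe_le_slackDist hz hg0 hδ).trans hr.le)
    linarith [hAε δ hδ]
  obtain ⟨w, hw, hNw, hle⟩ := exists_price_profit_sub_le h hT hconv hz hg hε hst hs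
  exact iInf_le_of_le w (iInf₂_le_of_le hw hNw hle)

end Duality

section DistanceFunctions

variable {m n : ℕ} {T : Set (Netput m n)} {z g : Netput m n} {p q : ℝ}

theorem sub_one_div_eq_one_div (hq : q ≠ 0) (hpq : 1 / p + 1 / q = 1) :
    (q - 1) / q = 1 / p := by
  rw [sub_div, div_self hq]
  linarith

theorem genDist_eq_iSup (hz : z ∈ T) (hg : 0 ≤ g) (hg0 : g ≠ 0) (hp : 1 < p)
    (hpq : 1 / p + 1 / q = 1) :
    genDist p T z g =
      ⨆ (w : Netput m n) (_ : 0 ≤ w)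
        (_ : suppCard g ^ ((q - 1) / q) * (∑ k ∈ supp g, (g k * w k) ^ q) ^ (1 / q) = 1),
        (profitDir T z g w - ((w ⬝ᵥ z : ℝ) : EReal)) := by
  have hconj : p.HolderConjugate q := Real.holderConjugate_iff.2 ⟨hp, by simpa using hpq⟩
  have hdual := slackDist_eq_iSup ((isConvexPolarPair_phiSum (supp_nonempty hg0) hp hpq).scale
    (Real.rpow_pos_of_pos (suppCard_pos hg0) (1 / p))) hz hg hg0
  simp only [phiSum_of_nonneg hconj.symm.nonneg] at hdual
  rw [sub_one_div_eq_one_div hconj.symm.ne_zero hpq]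
  exact hdual

theorem genDist_one : genDist 1 T z g = fareLovellDist T z g := by
  simp only [genDist, fareLovellDist, phiSum_of_nonneg zero_le_one, Real.rpow_one, div_one]

theorem fareLovellDist_eq_iSup (hz : z ∈ T) (hg : 0 ≤ g) (hg0 : g ≠ 0) :
    fareLovellDist T z g =
      ⨆ (w : Netput m n) (_ : 0 ≤ w)
        (_ : suppCard g * (supp g).sup' (supp_nonempty hg0) (fun k => w k * g k) = 1),
        (profitDir T z g w - ((w ⬝ᵥ z : ℝ) : EReal)) := by
  simp only [fun w : Netput m n => fun k => mul_comm (w k) (g k)]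
  exact slackDist_eq_iSup
    ((isConvexPolarPair_sum_sup' (supp_nonempty hg0)).scale (suppCard_pos hg0)) hz hg hg0

theorem add_max_zero_smul_mem (hz : z ∈ T) {v : Netput m n} {t : ℝ} (ht : z + t • v ∈ T) :
    z + max t 0 • v ∈ T := by
  rcases max_choice t 0 with h | h <;> rw [h]
  · exact ht
  · rwa [zero_smul, add_zero]

theorem asymmetricDist_eq_slackDist (hT : IsLowerSet T) (hz : z ∈ T) (hg : 0 ≤ g) (hg0 : g ≠ 0) :
    asymmetricDist T z g = slackDist (fun δ => (supp g).sup' (supp_nonempty hg0) δ) T z g := by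
  refine le_antisymm (iSup₂_le fun j hj => iSup₂_le fun t ht => ?_)
    ((slackDist_le_iff hz hg0).2 fun δ hδ => ?_)
  · have hmem : Pi.single j (max t 0) ∈ slackSet T z g := by
      refine ⟨Pi.single_nonneg.2 (le_max_right _ _), ?_⟩
      rw [← Pi.single_mul_left, ← smul_eq_mul, Pi.single_smul]
      exact add_max_zero_smul_mem hz ht
    refine (EReal.coe_le_coe_iff.2 ?_).trans (coe_le_slackDist hz hg0 hmem)
    calc t ≤ (Pi.single j (max t 0) : Netput m n) j := by
          rw [Pi.single_eq_same]; exact le_max_left _ _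
      _ ≤ _ := le_sup' _ hj
  · obtain ⟨j, hj, hmax⟩ := exists_mem_eq_sup' (supp_nonempty hg0) δ
    have hmem : z + δ j • Pi.single j (g j) ∈ T := by
      rw [← Pi.single_smul, smul_eq_mul]
      exact hT (add_le_add_right (update_le_iff.2
        ⟨le_rfl, fun k _ => mul_nonneg (hδ.1 k) (hg k)⟩) z) hδ.2
    rw [hmax]
    exact le_iSup₂_of_le j hj (le_iSup₂_of_le (δ j) hmem le_rfl)

theorem asymmetricDist_eq_iSup (hT : IsLowerSet T) (hz : z ∈ T) (hg : 0 ≤ g) (hg0 : g ≠ 0) :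
    asymmetricDist T z g =
      ⨆ (w : Netput m n) (_ : 0 ≤ w) (_ : w ⬝ᵥ g = 1),
        (profitDir T z g w - ((w ⬝ᵥ z : ℝ) : EReal)) := by
  simp only [asymmetricDist_eq_slackDist hT hz hg hg0, dotProduct_eq_sum_supp (g := g)]
  exact slackDist_eq_iSup (isConvexPolarPair_sup'_sum (supp_nonempty hg0)) hz hg hg0

theorem multDist_eq_iInf (hT : IsLowerSet T) (hbdd : Bornology.IsBounded (dominating T z))
    (hconv : Convex ℝ T) (hz : z ∈ T) (hg : 0 ≤ g) (hg0 : g ≠ 0) :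
    multDist T z g =
      ⨅ (w : Netput m n) (_ : 0 ≤ w)
        (_ : suppCard g * ∏ k ∈ supp g, (g k * w k) ^ (1 / suppCard g) = 1),
        (profit T z w - ((w ⬝ᵥ z : ℝ) : EReal)) := by
  have hK := supp_nonempty hg0
  exact slackDist_eq_iInf (isConcavePolarPair_geomMean hK) hT hconv hz hg hg0 fun _ hη =>
    exists_shift_le_add_of_mem_slackSet hbdd hg continuous_geomMean.continuousOn
      (isNormalization_geomMean hK).dependsOn hη

theorem genDist_eq_iInf (hT : IsLowerSet T) (hbdd : Bornology.IsBounded (dominating T z))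
    (hconv : Convex ℝ T) (hz : z ∈ T) (hg : 0 ≤ g) (hg0 : g ≠ 0) (hp : p < 1) (hp0 : p ≠ 0)
    (hpq : 1 / p + 1 / q = 1) :
    genDist p T z g =
      ⨅ (w : Netput m n) (_ : 0 ≤ w)
        (_ : suppCard g ^ ((q - 1) / q) * phiSum q (supp g) (fun k => g k * w k) = 1),
        (profit T z w - ((w ⬝ᵥ z : ℝ) : EReal)) := by
  have hK := supp_nonempty hg0
  have hq0 : q ≠ 0 := by rintro rfl; simp [hp.ne] at hpq
  rw [sub_one_div_eq_one_div hq0 hpq]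
  exact slackDist_eq_iInf ((isConcavePolarPair_phiSum hK hp hp0 hpq).scale
    (Real.rpow_pos_of_pos (suppCard_pos hg0) (1 / p))) hT hconv hz hg hg0 fun _ hη =>
    exists_shift_le_add_of_mem_slackSet hbdd hg
      (continuousOn_const.mul (continuousOn_phiSum hp0 hK))
      ((isNormalization_phiSum hp0).const_mul _).dependsOn hη

theorem directionalDist_eq_slackDist (hT : IsLowerSet T) (hz : z ∈ T) (hg : 0 ≤ g) (hg0 : g ≠ 0) :
    directionalDist T z g = slackDist (fun δ => (supp g).inf' (supp_nonempty hg0) δ) T z g := by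
  refine le_antisymm (iSup₂_le fun t ht => ?_) ((slackDist_le_iff hz hg0).2 fun δ hδ => ?_)
  · have hmem : (fun _ => max t 0) ∈ slackSet T z g :=
      ⟨fun _ => le_max_right _ _, add_max_zero_smul_mem hz ht⟩
    refine (EReal.coe_le_coe_iff.2 ?_).trans (coe_le_slackDist hz hg0 hmem)
    exact le_inf' _ _ fun _ _ => le_max_left _ _
  · refine le_iSup₂_of_le _ (hT (add_le_add_right (fun k => ?_) z) hδ.2) le_rfl
    by_cases hk : k ∈ supp g
    · exact mul_le_mul_of_nonneg_right (inf'_le _ hk) (hg k)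
    · simp [apply_eq_zero_of_notMem_supp hk]

theorem directionalDist_eq_iInf (hT : IsLowerSet T) (hconv : Convex ℝ T) (hz : z ∈ T)
    (hg : 0 ≤ g) (hg0 : g ≠ 0) :
    directionalDist T z g =
      ⨅ (w : Netput m n) (_ : 0 ≤ w) (_ : w ⬝ᵥ g = 1),
        (profit T z w - ((w ⬝ᵥ z : ℝ) : EReal)) := by
  have hK := supp_nonempty hg0
  simp only [directionalDist_eq_slackDist hT hz hg hg0, dotProduct_eq_sum_supp (g := g)]
  refine slackDist_eq_iInf (isConcavePolarPair_inf'_sum hK) hT hconv hz hg hg0 fun η hη =>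
    ⟨η, hη, fun δ _ => ?_⟩
  obtain ⟨j, hj, hmin⟩ := exists_mem_eq_inf' hK δ
  exact (inf'_le _ hj).trans_eq (by rw [hmin])

end DistanceFunctions

end NetputDuality

theorem proposition13_general {m n : ℕ} (T : Set (Netput m n)) (hT : IsLowerSet T)
    (z : Netput m n) (hz : z ∈ T) (g : Netput m n) (hg_nonneg : 0 ≤ g) (hg : g ≠ 0) :
    (∀ p q : ℝ, 1 < p → 1 / p + 1 / q = 1 →
      genDist p T z g =
        ⨆ (w : Netput m n) (_ : 0 ≤ w)
          (_ : suppCard g ^ ((q - 1) / q) * (∑ k ∈ supp g, (g k * w k) ^ q) ^ (1 / q) = 1),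
          (profitDir T z g w - ((w ⬝ᵥ z : ℝ) : EReal))) ∧
    (genDist 1 T z g = fareLovellDist T z g ∧
      fareLovellDist T z g =
        ⨆ (w : Netput m n) (_ : 0 ≤ w)
          (_ : suppCard g * (supp g).sup' (supp_nonempty hg) (fun k => w k * g k) = 1),
          (profitDir T z g w - ((w ⬝ᵥ z : ℝ) : EReal))) ∧
    (asymmetricDist T z g =
      ⨆ (w : Netput m n) (_ : 0 ≤ w) (_ : w ⬝ᵥ g = 1),
        (profitDir T z g w - ((w ⬝ᵥ z : ℝ) : EReal))) ∧
    (Convex ℝ T →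
      (Bornology.IsBounded (dominating T z) →
        (multDist T z g =
          ⨅ (w : Netput m n) (_ : 0 ≤ w)
            (_ : suppCard g * ∏ k ∈ supp g, (g k * w k) ^ (1 / suppCard g) = 1),
            (profit T z w - ((w ⬝ᵥ z : ℝ) : EReal))) ∧
        (∀ p q : ℝ, p < 1 → p ≠ 0 → 1 / p + 1 / q = 1 →
          genDist p T z g =
            ⨅ (w : Netput m n) (_ : 0 ≤ w)
              (_ : suppCard g ^ ((q - 1) / q) * phiSum q (supp g) (fun k => g k * w k) = 1),
              (profit T z w - ((w ⬝ᵥ z : ℝ) : EReal)))) ∧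
      (directionalDist T z g =
        ⨅ (w : Netput m n) (_ : 0 ≤ w) (_ : w ⬝ᵥ g = 1),
          (profit T z w - ((w ⬝ᵥ z : ℝ) : EReal)))) :=
  ⟨fun _ _ => genDist_eq_iSup hz hg_nonneg hg,
    ⟨genDist_one, fareLovellDist_eq_iSup hz hg_nonneg hg⟩,
    asymmetricDist_eq_iSup hT hz hg_nonneg hg,
    fun hconv => ⟨fun hbdd => ⟨multDist_eq_iInf hT hbdd hconv hz hg_nonneg hg,
        fun _ _ => genDist_eq_iInf hT hbdd hconv hz hg_nonneg hg⟩,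
      directionalDist_eq_iInf hT hconv hz hg_nonneg hg⟩⟩

theorem proposition13 {m n : ℕ} (T : Set (Netput m n)) (hT : IsTechnology T)
    (z : Netput m n) (hz : z ∈ T) (g : Netput m n) (hg_nonneg : 0 ≤ g) (hg : g ≠ 0) :
    -- (a) `1 < p < ∞`
    (∀ p q : ℝ, 1 < p → 1 / p + 1 / q = 1 →
      genDist p T z g =
        ⨆ (w : Netput m n) (_ : 0 ≤ w)
          (_ : suppCard g ^ ((q - 1) / q) * (∑ k ∈ supp g, (g k * w k) ^ q) ^ (1 / q) = 1),
          (profitDir T z g w - ((w ⬝ᵥ z : ℝ) : EReal))) ∧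
    -- (b) `p = 1`
    (genDist 1 T z g = fareLovellDist T z g ∧
      fareLovellDist T z g =
        ⨆ (w : Netput m n) (_ : 0 ≤ w)
          (_ : suppCard g * (supp g).sup' (supp_nonempty hg) (fun k => w k * g k) = 1),
          (profitDir T z g w - ((w ⬝ᵥ z : ℝ) : EReal))) ∧
    -- (c) `p = ∞`
    (asymmetricDist T z g =
      ⨆ (w : Netput m n) (_ : 0 ≤ w) (_ : w ⬝ᵥ g = 1),
        (profitDir T z g w - ((w ⬝ᵥ z : ℝ) : EReal))) ∧
    (Convex ℝ T →
      -- (d) `p = 0`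
      (multDist T z g =
        ⨅ (w : Netput m n) (_ : 0 ≤ w)
          (_ : suppCard g * ∏ k ∈ supp g, (g k * w k) ^ (1 / suppCard g) = 1),
          (profit T z w - ((w ⬝ᵥ z : ℝ) : EReal))) ∧
      -- (e) `p < 1`, `p ≠ 0`
      (∀ p q : ℝ, p < 1 → p ≠ 0 → 1 / p + 1 / q = 1 →
        genDist p T z g =
          ⨅ (w : Netput m n) (_ : 0 ≤ w)
            (_ : suppCard g ^ ((q - 1) / q) * phiSum q (supp g) (fun k => g k * w k) = 1),
            (profit T z w - ((w ⬝ᵥ z : ℝ) : EReal))) ∧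
      -- (f) `p = -∞`
      (directionalDist T z g =
        ⨅ (w : Netput m n) (_ : 0 ≤ w) (_ : w ⬝ᵥ g = 1),
          (profit T z w - ((w ⬝ᵥ z : ℝ) : EReal)))) := by
  obtain ⟨ha, hb, hc, hconv⟩ := proposition13_general T
    (fun u u' hle hu => hT.free_disposal u hu u' hle) z hz g hg_nonneg hg
  exact ⟨ha, hb, hc, fun h => and_assoc.1 ((hconv h).imp_left fun hde => hde (hT.bounded z hz))⟩
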